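/- All graphs are finite and simple. For integers $p\ge q\ge 1$ let $G_{p,q}$ be the graph on $\{0,\dots,p-1\}$ in which $u$ and $v$ are adjacent if and only if $q\le |u-v|\le p-q$; for $p\ge 2q$ it is called a circular clique. The circular chromatic number $\chi_c(G)$ of a graph $G$ is the minimum of $p/q$ over all integers $p\ge q\ge 1$ for which there is a graph homomorphism $G\to G_{p,q}$. For vertices $x,y$ of $G$ at distance $2$, the elementary fold of $x$ and $y$ is the quotient homomorphism $G\to G_{xy}$, where $G_{xy}$ is obtained from $G$ by identifying $x$ and $y$. A graph $G$ folds to a graph $H$ if some sequence of zero or more elementary folds, starting from $G$, ends in a graph isomorphic to $H$. **Theorem.** Let $p,q$ be positive integers with $p\ge 2q$. (i) If $q=1$ or $p=2q+1$, then every connected graph $G$ with $\chi_c(G)=p/q$ folds to $G_{p,q}$. (ii) Otherwise (that is, if $q\ne 1$ and $p\ne 2q+1$), there is a connected graph $G$ with $\chi_c(G)=p/q$ that does not fold to $G_{p,q}$. -/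

import Mathlib

universe u v

/-- The circular clique `G_{p,q}` on `{0, …, p-1}`: `a ~ b` iff `q ≤ |a - b| ≤ p - q`.
(The condition `a ≠ b` is automatic for `q ≥ 1`. For `q ≤ p < 2q` the graph has no edge.) -/
def circularClique (p q : ℕ) : SimpleGraph (Fin p) where
  Adj a b := a ≠ b ∧ (q : ℤ) ≤ |(a : ℤ) - (b : ℤ)| ∧ |(a : ℤ) - (b : ℤ)| ≤ (p : ℤ) - (q : ℤ)
  symm := ⟨fun a b h => by
    rw [abs_sub_comm (b : ℤ) (a : ℤ)]
    exact ⟨h.1.symm, h.2⟩⟩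
  loopless := ⟨fun _ h => h.1 rfl⟩

/-- `r` is the circular chromatic number of `G`: the minimum of `p / q` over the pairs of integers
`p ≥ q ≥ 1` such that `G` has a `(p,q)`-colouring, i.e. a homomorphism to `G_{p,q}`. -/
def IsCircularChromaticNumber {V : Type u} (G : SimpleGraph V) (r : ℚ) : Prop :=
  IsLeast {s : ℚ | ∃ p q : ℕ, 0 < q ∧ q ≤ p ∧ s = (p : ℚ) / (q : ℚ) ∧
    Nonempty (G →g circularClique p q)} r

/-- The equivalence relation that identifies `x` with `y` and nothing else. -/
def identifySetoid {V : Type u} (x y : V) : Setoid V where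
  r a b := a = b ∨ (a = x ∧ b = y) ∨ (a = y ∧ b = x)
  iseqv := ⟨fun _ => Or.inl rfl, by grind, by grind⟩

/-- The graph `G_{xy}` obtained from `G` by identifying the vertices `x` and `y`. -/
def identify {V : Type u} (G : SimpleGraph V) (x y : V) :
    SimpleGraph (Quotient (identifySetoid x y)) :=
  G.map (Quotient.mk (identifySetoid x y))

/-- The elementary fold `G → G_{xy}`, for vertices `x` and `y` at distance `2`. -/
def elementaryFold {V : Type u} (G : SimpleGraph V) (x y : V) (h : G.dist x y = 2) :
    G →g identify G x y :=
  SimpleGraph.Hom.map (Quotient.mk (identifySetoid x y)) G <| by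
    have hxy : ¬ G.Adj x y := fun hadj => by
      rw [SimpleGraph.dist_eq_one_iff_adj.mpr hadj] at h
      exact absurd h (by norm_num)
    intro a b hab heq
    rcases Quotient.exact heq with h1 | ⟨h1, h2⟩ | ⟨h1, h2⟩
    · exact hab.ne h1
    · exact hxy (h1 ▸ h2 ▸ hab)
    · exact hxy (h1 ▸ h2 ▸ hab.symm)

/-- A homomorphism `f : G → H` is a folding if it is a composition of (zero or more) elementary
folds, followed by an isomorphism of the resulting graph onto `H`. -/
inductive IsFolding {W : Type v} {H : SimpleGraph W} :
    {V : Type u} → {G : SimpleGraph V} → (G →g H) → Prop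
  | iso {V : Type u} {G : SimpleGraph V} (e : G ≃g H) : IsFolding e.toHom
  | comp {V : Type u} {G : SimpleGraph V} (x y : V) (h : G.dist x y = 2)
      (f : identify G x y →g H) (hf : IsFolding f) :
      IsFolding (f.comp (elementaryFold G x y h))

/-- `G` folds to `H`: there is a folding `G → H`. -/
def FoldsTo {V : Type u} {W : Type v} (G : SimpleGraph V) (H : SimpleGraph W) : Prop :=
  ∃ f : G →g H, IsFolding f

/-!
Two vertices with a common neighbour and the same image under a homomorphism to `H` can be folded
together without losing that homomorphism. Once no such fold is left, every homomorphism to `H` is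
injective on neighbourhoods, and modifying a homomorphism locally becomes a strong constraint.
For `H = K_n`, switching colours on a Kempe component, which local injectivity reduces to a star,
shows that any two neighbours of a vertex are adjacent, so a connected graph is complete. For a
cycle `H`, a connected non-bipartite graph is the orbit of a successor permutation `s` lying over
the rotation; reflecting a homomorphism on an arc `v, s v, …, sⁿ v` that wraps once around `H` shows
`sⁿ = 1`, so the graph is `H` itself. These are the cases `q = 1` and `p = 2q + 1`, `H = G_{p,q}`.

In the remaining cases with `p > 2q`, deleting the edge `{0, q + 1}` from `G_{p,q}` leaves the graph
connected and its independence number equal to `q`, and double counting independent arcs gives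
`p / q ≤ a / b` for every `(a, b)`-colouring. Foldings are surjective on edges, so the smaller graph
does not fold to `G_{p,q}`. For `p = 2q` with `q ≥ 2`, the graph `K₂` is too small.
-/

section Foldings

variable {V : Type u} {W : Type v} {G : SimpleGraph V} {H : SimpleGraph W}

theorem dist_eq_two_of_adj_of_adj {x y z : V} (hx : G.Adj z x) (hy : G.Adj z y) (hne : x ≠ y)
    (hxy : ¬ G.Adj x y) : G.dist x y = 2 := by
  rw [SimpleGraph.dist, SimpleGraph.edist_eq_two_iff.2 ⟨hne, hxy, z, hx.symm, hy.symm⟩]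
  rfl

theorem card_quotient_identifySetoid_lt [Finite V] {x y : V} (hxy : x ≠ y) :
    Nat.card (Quotient (identifySetoid x y)) < Nat.card V := by
  refine (Nat.card_le_card_of_surjective _ Quotient.mk_surjective).lt_of_ne fun h => hxy ?_
  have hbij := (Nat.bijective_iff_surjective_and_card (Quotient.mk (identifySetoid x y))).2
    ⟨Quotient.mk_surjective, h.symm⟩
  exact hbij.injective (Quotient.sound (Or.inr (Or.inl ⟨rfl, rfl⟩)))

/-- The homomorphism `G_{xy} → H` induced by a homomorphism `G → H` that identifies `x` and `y`. -/
def identifyLift (f : G →g H) {x y : V} (h : f x = f y) : identify G x y →g H where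
  toFun := Quotient.lift f <| by
    rintro a b (rfl | ⟨rfl, rfl⟩ | ⟨rfl, rfl⟩)
    exacts [rfl, h, h.symm]
  map_rel' := by
    rintro _ _ ⟨-, a, b, hab, rfl, rfl⟩
    exact f.map_adj hab

theorem IsFolding.surjective {f : G →g H} (hf : IsFolding f) : Function.Surjective f := by
  induction hf with
  | iso e => exact e.surjective
  | comp x y h f _ ih => exact ih.comp Quotient.mk_surjective

theorem IsFolding.exists_adj {f : G →g H} (hf : IsFolding f) {a b : W} (hab : H.Adj a b) :
    ∃ x y, G.Adj x y ∧ f x = a ∧ f y = b := by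
  induction hf with
  | iso e => exact ⟨e.symm a, e.symm b, e.symm.map_adj_iff.2 hab, by simp, by simp⟩
  | comp x y h f _ ih =>
    obtain ⟨_, _, ⟨_, x', y', hxy, rfl, rfl⟩, rfl, rfl⟩ := ih
    exact ⟨x', y', hxy, rfl, rfl⟩

theorem IsFolding.mapEdgeSet_surjective {f : G →g H} (hf : IsFolding f) :
    Function.Surjective f.mapEdgeSet := by
  rintro ⟨⟨a, b⟩, hab⟩
  obtain ⟨x, y, hxy, rfl, rfl⟩ := hf.exists_adj hab
  exact ⟨⟨s(x, y), hxy⟩, rfl⟩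

theorem IsFolding.iso_comp {X : Type*} {K : SimpleGraph X} {f : G →g H} (hf : IsFolding f)
    (e : H ≃g K) : IsFolding (e.toHom.comp f) := by
  induction hf with
  | iso e' => exact .iso (e'.trans e)
  | comp x y h f _ ih => exact .comp x y h _ ih

theorem FoldsTo.trans_iso {X : Type*} {K : SimpleGraph X} (h : FoldsTo G H) (e : H ≃g K) :
    FoldsTo G K :=
  let ⟨_, hf⟩ := h
  ⟨_, hf.iso_comp e⟩

theorem FoldsTo.connected (h : FoldsTo G H) (hG : G.Connected) : H.Connected :=
  let ⟨f, hf⟩ := h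
  hG.map f hf.surjective

theorem FoldsTo.card_le [Finite V] (h : FoldsTo G H) : Nat.card W ≤ Nat.card V :=
  let ⟨f, hf⟩ := h
  Nat.card_le_card_of_surjective f hf.surjective

theorem not_foldsTo_of_lt [Finite V] {G G' : SimpleGraph V} (hlt : G < G') : ¬ FoldsTo G G' := by
  rintro ⟨f, hf⟩
  exact (Set.ncard_lt_ncard (SimpleGraph.edgeSet_strict_mono hlt)).not_ge
    (Nat.card_le_card_of_surjective _ hf.mapEdgeSet_surjective)

/-- `G` is fold-reduced over `H` if every homomorphism `G → H` is injective on neighbourhoods; that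
is, no homomorphism `G → H` factors through an elementary fold of `G`. -/
def IsFoldReduced (G : SimpleGraph V) (H : SimpleGraph W) : Prop :=
  ∀ (f : G →g H) (z : V), Set.InjOn f (G.neighborSet z)

theorem exists_foldsTo_isFoldReduced {V : Type u} [Finite V] {G : SimpleGraph V} (f : G →g H) :
    ∃ (V' : Type u) (G' : SimpleGraph V'),
      FoldsTo G G' ∧ IsFoldReduced G' H ∧ Nonempty (G' →g H) := by
  induction hn : Nat.card V using Nat.strong_induction_on generalizing V with
  | _ n ih =>
    by_cases hred : IsFoldReduced G H
    · exact ⟨V, G, ⟨_, .iso .refl⟩, hred, ⟨f⟩⟩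
    · simp only [IsFoldReduced, Set.InjOn, not_forall] at hred
      obtain ⟨f, z, x, hx, y, hy, hxy, hne⟩ := hred
      have hdist := dist_eq_two_of_adj_of_adj hx hy hne fun hadj => (f.map_adj hadj).ne hxy
      obtain ⟨V', G', ⟨g, hg⟩, hG'⟩ :=
        ih _ (hn ▸ card_quotient_identifySetoid_lt hne) (identifyLift f hxy) rfl
      exact ⟨V', G', ⟨_, .comp x y hdist g hg⟩, hG'⟩

end Foldings

section Switching

variable {V : Type u} {W : Type v} {G : SimpleGraph V} {H : SimpleGraph W}

open Classical in
/-- The homomorphism that agrees with `f` on `S` and with `g` off `S`. -/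
noncomputable def piecewiseHom (f g : G →g H) (S : Set V)
    (hS : ∀ a ∈ S, ∀ b ∉ S, G.Adj a b → H.Adj (f a) (g b)) : G →g H where
  toFun := S.piecewise f g
  map_rel' {a b} hab := by
    by_cases ha : a ∈ S <;> by_cases hb : b ∈ S <;>
      simp only [Set.piecewise, ha, hb, if_true, if_false]
    exacts [f.map_adj hab, hS a ha b hb hab, (hS b hb a ha hab.symm).symm, g.map_adj hab]

theorem piecewiseHom_of_mem {f g : G →g H} {S : Set V}
    {hS : ∀ a ∈ S, ∀ b ∉ S, G.Adj a b → H.Adj (f a) (g b)} {a : V} (ha : a ∈ S) :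
    piecewiseHom f g S hS a = f a :=
  if_pos ha

theorem piecewiseHom_of_notMem {f g : G →g H} {S : Set V}
    {hS : ∀ a ∈ S, ∀ b ∉ S, G.Adj a b → H.Adj (f a) (g b)} {a : V} (ha : a ∉ S) :
    piecewiseHom f g S hS a = g a :=
  if_neg ha

theorem forall_of_adj_closed (hG : G.Connected) {P : V → Prop} {a : V} (ha : P a)
    (hP : ∀ a b, G.Adj a b → P a → P b) (b : V) : P b := by
  have hab := (SimpleGraph.reachable_iff_reflTransGen a b).1 (hG a b)
  induction hab with
  | refl => exact ha
  | tail _ hbc ih => exact hP _ _ hbc ih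

theorem IsFoldReduced.exists_adj_not_adj (hred : IsFoldReduced G H) (f : G →g H) {x y z : V}
    (hx : G.Adj z x) (hy : G.Adj z y) (hxy : x ≠ y) : ∃ u, G.Adj x u ∧ ¬ H.Adj (f y) (f u) := by
  classical
  by_contra! h
  let f' : G →g H :=
    { toFun := Function.update f x (f y)
      map_rel' := by
        intro a b hab
        rcases eq_or_ne a x with rfl | ha
        · simpa [hab.ne'] using h b hab
        rcases eq_or_ne b x with rfl | hb
        · simpa [hab.ne] using (h a hab.symm).symm
        · simpa [ha, hb] using f.map_adj hab }
  refine hxy (hred f' z hx hy ?_)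
  change Function.update f x (f y) x = Function.update f x (f y) y
  rw [Function.update_self, Function.update_of_ne hxy.symm]

theorem IsFoldReduced.exists_adj_ne (hG : G.Connected) (hred : IsFoldReduced G H) (f : G →g H)
    (h2 : ¬ G.Colorable 2) {v w : V} (hvw : G.Adj v w) : ∃ u, G.Adj v u ∧ u ≠ w := by
  classical
  by_contra! hv
  have hw : ∀ u, G.Adj w u → u = v := fun u hwu => by
    by_contra huv
    obtain ⟨t, hvt, ht⟩ := hred.exists_adj_not_adj f hvw.symm hwu (Ne.symm huv)
    obtain rfl := hv t hvt
    exact ht (f.map_adj hwu.symm)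
  have hall : ∀ b, b = v ∨ b = w := by
    refine forall_of_adj_closed hG (a := v) (Or.inl rfl) ?_
    rintro a b hab (rfl | rfl)
    exacts [Or.inr (hv b hab), Or.inl (hw b hab)]
  refine h2 ⟨⟨fun x => if x = v then 0 else 1, fun {a b} hab => ?_⟩⟩
  have hne := hab.ne
  have hne' := hab.ne'
  rcases hall a with rfl | rfl <;> rcases hall b with rfl | rfl <;> simp_all

end Switching

section CompleteGraphs

variable {V : Type u} {α : Type*} {G : SimpleGraph V}

theorem IsFoldReduced.adj_of_adj_of_adj (hred : IsFoldReduced G (⊤ : SimpleGraph α))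
    (c : G →g (⊤ : SimpleGraph α)) {x y z : V} (hx : G.Adj z x) (hy : G.Adj z y) (hxy : x ≠ y) :
    G.Adj x y := by
  classical
  by_contra hnadj
  -- By local injectivity, the Kempe component of `x` in the colours of `x` and `y` is a star.
  let S : Set V := {a | a = x ∨ G.Adj x a ∧ c a = c y}
  let swapColors : (⊤ : SimpleGraph α) →g (⊤ : SimpleGraph α) :=
    (SimpleGraph.Iso.completeGraph (Equiv.swap (c x) (c y))).toHom
  have hS : ∀ a ∈ S, ∀ b ∉ S, G.Adj a b →
      (⊤ : SimpleGraph α).Adj (swapColors.comp c a) (c b) := by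
    rintro a (rfl | ⟨hxa, hca⟩) b hb hab
    · have hcb : c y ≠ c b := fun h => hb (Or.inr ⟨hab, h.symm⟩)
      simpa [swapColors, SimpleGraph.Iso.completeGraph] using hcb
    · have hcb : c x ≠ c b := fun h => hb (Or.inl (hred c a hxa.symm hab h).symm)
      simpa [swapColors, SimpleGraph.Iso.completeGraph, hca] using hcb
  have hxS : x ∈ S := Or.inl rfl
  have hyS : y ∉ S := by
    rintro (h | h)
    exacts [hxy h.symm, hnadj h.1]
  refine hxy (hred (piecewiseHom (swapColors.comp c) c S hS) z hx hy ?_)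
  rw [piecewiseHom_of_mem hxS, piecewiseHom_of_notMem hyS]
  exact Equiv.swap_apply_left _ _

theorem IsFoldReduced.eq_top (hG : G.Connected) (hred : IsFoldReduced G (⊤ : SimpleGraph α))
    (c : G →g (⊤ : SimpleGraph α)) : G = ⊤ := by
  refine eq_top_iff.2 fun a b => forall_of_adj_closed hG (P := fun b => a ≠ b → G.Adj a b)
    (fun h => absurd rfl h) (fun x y hxy hax hay => ?_) b
  rcases eq_or_ne a x with rfl | hne
  · exact hxy
  · exact hred.adj_of_adj_of_adj c (hax hne).symm hxy hay

theorem foldsTo_top_of_chromaticNumber_eq [Finite V] (hG : G.Connected) {n : ℕ}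
    (hn : G.chromaticNumber = n) : FoldsTo G (⊤ : SimpleGraph (Fin n)) := by
  obtain ⟨c₀⟩ := SimpleGraph.chromaticNumber_le_iff_colorable.1 hn.le
  obtain ⟨V', G', hfold, hred, ⟨c⟩⟩ := exists_foldsTo_isFoldReduced c₀
  obtain rfl : G' = ⊤ := hred.eq_top (hfold.connected hG) c
  have ⟨f, _⟩ := hfold
  have hsurj : Function.Surjective c := fun i =>
    let ⟨v, hv⟩ := SimpleGraph.le_chromaticNumber_iff_forall_surjective.1 hn.ge (c.comp f) i
    ⟨f v, hv⟩
  exact hfold.trans_iso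
    (SimpleGraph.Iso.completeGraph (Equiv.ofBijective c ⟨c.injective_of_top_hom, hsurj⟩))

end CompleteGraphs

section Cycles

variable {V : Type u} {A : Type v} [AddCommGroup A] {g : A} {G : SimpleGraph V}

theorem circulantGraph_singleton_adj {a b : A} :
    (SimpleGraph.circulantGraph {g}).Adj a b ↔ a ≠ b ∧ (b = a + g ∨ a = b + g) := by
  rw [SimpleGraph.circulantGraph_adj]
  simp only [Set.mem_singleton_iff, sub_eq_iff_eq_add']
  grind

/-- The reflection `x ↦ 2c - x` of the circulant graph. -/
def circulantReflection (g c : A) :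
    SimpleGraph.circulantGraph {g} →g SimpleGraph.circulantGraph {g} where
  toFun x := c + c - x
  map_rel' {a b} hab := by
    rw [circulantGraph_singleton_adj] at hab ⊢
    grind

/-- The permutation `s` lifts `x ↦ x + g` along `f : G → circulantGraph {g}`, and the edges of `G`
are exactly the pairs `{v, s v}`. -/
structure IsSuccessorPerm (f : G →g SimpleGraph.circulantGraph {g}) (s : Equiv.Perm V) :
    Prop where
  adj_iff : ∀ a b, G.Adj a b ↔ b = s a ∨ a = s b
  map_apply : ∀ v, f (s v) = f v + g

theorem IsFoldReduced.exists_isSuccessorPerm (hG : G.Connected)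
    (hred : IsFoldReduced G (SimpleGraph.circulantGraph {g})) (h2 : ¬ G.Colorable 2)
    (f : G →g SimpleGraph.circulantGraph {g}) : ∃ s, IsSuccessorPerm f s := by
  have hnontriv : Nontrivial V := by
    by_contra h
    have := not_nontrivial_iff_subsingleton.1 h
    exact h2 ⟨⟨fun _ => 0, fun hab => absurd (Subsingleton.elim _ _) hab.ne⟩⟩
  have hnbrs (v : V) :
      (∃ w, G.Adj v w ∧ f w = f v + g) ∧ ∃ w, G.Adj v w ∧ f v = f w + g := by
    obtain ⟨w, hw⟩ := hG.preconnected.exists_adj_of_nontrivial v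
    obtain ⟨u, hu, huw⟩ := hred.exists_adj_ne hG f h2 hw
    have hfne : f u ≠ f w := fun h => huw (hred f v hu hw h)
    have hfw := (circulantGraph_singleton_adj.1 (f.map_adj hw)).2
    have hfu := (circulantGraph_singleton_adj.1 (f.map_adj hu)).2
    grind
  choose s hs hfs using fun v => (hnbrs v).1
  choose t ht hft using fun v => (hnbrs v).2
  have hadj {a b : V} (hab : G.Adj a b) (h : f b = f a + g) : b = s a :=
    hred f a hab (hs a) (h.trans (hfs a).symm)
  refine ⟨⟨s, t, fun v => ?_, fun v => (hadj (ht v).symm (hft v)).symm⟩,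
    fun a b => ⟨fun hab => ?_, ?_⟩, hfs⟩
  · exact hred f (s v) (ht (s v)) (hs v).symm (add_right_cancel ((hft (s v)).symm.trans (hfs v)))
  · exact (circulantGraph_singleton_adj.1 (f.map_adj hab)).2.imp (hadj hab) (hadj hab.symm)
  · rintro (rfl | rfl)
    exacts [hs a, (hs b).symm]

namespace IsSuccessorPerm

variable {f : G →g SimpleGraph.circulantGraph {g}} {s : Equiv.Perm V}

theorem adj_apply (hs : IsSuccessorPerm f s) (v : V) : G.Adj v (s v) :=
  (hs.adj_iff v (s v)).2 (Or.inl rfl)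

theorem map_inv_apply (hs : IsSuccessorPerm f s) (v : V) : f (s⁻¹ v) = f v - g := by
  rw [eq_sub_iff_add_eq, ← hs.map_apply, Equiv.Perm.inv_def, Equiv.apply_symm_apply]

theorem map_zpow_apply (hs : IsSuccessorPerm f s) (k : ℤ) (v : V) :
    f ((s ^ k) v) = f v + k • g := by
  induction k generalizing v with
  | zero => simp
  | succ i ih => rw [zpow_add_one, Equiv.Perm.mul_apply, ih, hs.map_apply, add_one_zsmul]; abel
  | pred i ih => rw [zpow_sub_one, Equiv.Perm.mul_apply, ih, hs.map_inv_apply, sub_one_zsmul]; abel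

theorem map_pow_apply (hs : IsSuccessorPerm f s) (i : ℕ) (v : V) :
    f ((s ^ i) v) = f v + i • g := by
  simpa using hs.map_zpow_apply i v

theorem map_eq_of_adj_of_notMem_arc (hs : IsSuccessorPerm f s) {v a b : V} {n : ℕ} (hn : n • g = 0)
    (ha : ∃ i ≤ n, (s ^ i) v = a) (hb : ¬ ∃ i ≤ n, (s ^ i) v = b) (hab : G.Adj a b) :
    f a = f v := by
  obtain ⟨i, hi, rfl⟩ := ha
  rcases (hs.adj_iff _ _).1 hab with rfl | hsb
  · obtain rfl | hlt := hi.eq_or_lt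
    · rw [hs.map_pow_apply, hn, add_zero]
    · exact absurd ⟨i + 1, hlt, by rw [pow_succ', Equiv.Perm.mul_apply]⟩ hb
  · cases i with
    | zero => rfl
    | succ j =>
      rw [pow_succ', Equiv.Perm.mul_apply] at hsb
      exact absurd ⟨j, by omega, s.injective hsb⟩ hb

-- Reflecting `f` on an arc `v, s v, …, sⁿ v` with `f (sⁿ v) = f v` fixes the values at its ends.
theorem inv_apply_mem_arc (hs : IsSuccessorPerm f s)
    (hred : IsFoldReduced G (SimpleGraph.circulantGraph {g})) {n : ℕ} (hn0 : 0 < n)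
    (hn : n • g = 0) (v : V) : ∃ i ≤ n, (s ^ i) v = s⁻¹ v := by
  by_contra hinv
  let S : Set V := {a | ∃ i ≤ n, (s ^ i) v = a}
  let f' := piecewiseHom ((circulantReflection g (f v)).comp f) f S fun a ha b hb hab => by
    have hfa : (circulantReflection g (f v)).comp f a = f a := by
      change f v + f v - f a = f a
      rw [hs.map_eq_of_adj_of_notMem_arc hn ha hb hab, add_sub_cancel_right]
    exact hfa ▸ f.map_adj hab
  have hsv : s v ∈ S := ⟨1, hn0, rfl⟩
  have hne : s v ≠ s⁻¹ v := fun h => hinv (h ▸ hsv)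
  have hpred : G.Adj v (s⁻¹ v) := (hs.adj_iff _ _).2 (Or.inr (by simp))
  refine hne (hred f' v (hs.adj_apply v) hpred ?_)
  rw [piecewiseHom_of_mem (S := S) hsv, piecewiseHom_of_notMem (S := S) hinv, hs.map_inv_apply]
  change f v + f v - f (s v) = f v - g
  rw [hs.map_apply]
  abel

theorem pow_addOrderOf (hs : IsSuccessorPerm f s)
    (hred : IsFoldReduced G (SimpleGraph.circulantGraph {g})) : s ^ addOrderOf g = 1 := by
  ext v
  rcases (addOrderOf g).eq_zero_or_pos with h0 | hpos
  · simp [h0]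
  obtain ⟨i, hi, hiv⟩ := hs.inv_apply_mem_arc hred hpos (addOrderOf_nsmul_eq_zero g) v
  have hreturn : (s ^ (i + 1)) v = v := by
    rw [pow_succ', Equiv.Perm.mul_apply, hiv, Equiv.Perm.inv_def, Equiv.apply_symm_apply]
  have hdvd : addOrderOf g ∣ i + 1 := by
    have hfv := hs.map_pow_apply (i + 1) v
    rw [hreturn, left_eq_add] at hfv
    exact addOrderOf_dvd_of_nsmul_eq_zero hfv
  have hne_one : addOrderOf g ≠ 1 := fun h => by
    apply (f.map_adj (hs.adj_apply v)).ne
    rw [hs.map_apply, left_eq_add, AddMonoid.addOrderOf_eq_one_iff.1 h]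
  obtain hlt | heq : i < addOrderOf g ∨ i = addOrderOf g := hi.lt_or_eq
  · rwa [(Nat.le_of_dvd i.succ_pos hdvd).antisymm hlt]
  · rw [heq, Nat.dvd_add_right dvd_rfl, Nat.dvd_one] at hdvd
    exact absurd hdvd hne_one

theorem sameCycle (hs : IsSuccessorPerm f s) (hG : G.Connected) (a b : V) : s.SameCycle a b := by
  refine forall_of_adj_closed hG (Equiv.Perm.SameCycle.refl s a) (fun x y hxy hax => ?_) b
  rcases (hs.adj_iff x y).1 hxy with rfl | rfl
  exacts [hax.apply_right, Equiv.Perm.sameCycle_apply_right.1 hax]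

theorem injective (hs : IsSuccessorPerm f s) (hG : G.Connected)
    (hred : IsFoldReduced G (SimpleGraph.circulantGraph {g})) : Function.Injective f := by
  intro a b hab
  obtain ⟨k, rfl⟩ := hs.sameCycle hG a b
  rw [hs.map_zpow_apply, left_eq_add, ← addOrderOf_dvd_iff_zsmul_eq_zero] at hab
  obtain ⟨d, rfl⟩ := hab
  rw [zpow_mul, zpow_natCast, hs.pow_addOrderOf hred, one_zpow, Equiv.Perm.one_apply]

theorem surjective (hs : IsSuccessorPerm f s) [Nonempty V]
    (hg : ∀ x, x ∈ AddSubgroup.zmultiples g) : Function.Surjective f := by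
  intro x
  obtain ⟨v⟩ := ‹Nonempty V›
  obtain ⟨k, hk⟩ := AddSubgroup.mem_zmultiples_iff.1 (hg (x - f v))
  exact ⟨(s ^ k) v, by rw [hs.map_zpow_apply, hk, add_sub_cancel]⟩

theorem adj_of_map_adj (hs : IsSuccessorPerm f s) (hf : Function.Injective f) {a b : V}
    (hab : (SimpleGraph.circulantGraph {g}).Adj (f a) (f b)) : G.Adj a b := by
  rw [hs.adj_iff]
  exact (circulantGraph_singleton_adj.1 hab).2.imp (fun h => hf (h.trans (hs.map_apply a).symm))
    fun h => hf (h.trans (hs.map_apply b).symm)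

end IsSuccessorPerm

theorem foldsTo_circulantGraph_singleton [Finite V] (hG : G.Connected) (h2 : ¬ G.Colorable 2)
    (hg : ∀ x, x ∈ AddSubgroup.zmultiples g) (f₀ : G →g SimpleGraph.circulantGraph {g}) :
    FoldsTo G (SimpleGraph.circulantGraph {g}) := by
  obtain ⟨V', G', hfold, hred, ⟨f⟩⟩ := exists_foldsTo_isFoldReduced f₀
  have hG' := hfold.connected hG
  have ⟨fold, _⟩ := hfold
  obtain ⟨s, hs⟩ := hred.exists_isSuccessorPerm hG' (fun h => h2 (h.of_hom fold)) f
  have := hG'.nonempty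
  have hinj := hs.injective hG' hred
  exact hfold.trans_iso ⟨Equiv.ofBijective f ⟨hinj, hs.surjective hg⟩,
    ⟨hs.adj_of_map_adj hinj, f.map_adj⟩⟩

end Cycles

section CircularCliques

variable {p q : ℕ}

theorem circularClique_adj_iff (hq : 0 < q) {a b : Fin p} :
    (circularClique p q).Adj a b ↔
      ((a : ℕ) + q ≤ b ∧ (b : ℕ) + q ≤ a + p) ∨ ((b : ℕ) + q ≤ a ∧ (a : ℕ) + q ≤ b + p) := by
  simp only [circularClique, ne_eq, Fin.ext_iff]
  rcases abs_cases ((a : ℤ) - (b : ℤ)) with ⟨h, h'⟩ | ⟨h, h'⟩ <;> rw [h] <;> omega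

theorem circularClique_one (n : ℕ) : circularClique n 1 = ⊤ := by
  ext a b
  rw [circularClique_adj_iff one_pos, SimpleGraph.top_adj, ne_eq, Fin.ext_iff]
  omega

theorem nonempty_circularClique_hom_of_mul_le {p' q' : ℕ} (hq : 0 < q) (hq' : 0 < q')
    (h : p * q' ≤ p' * q) : Nonempty (circularClique p q →g circularClique p' q') := by
  have hdiv {x y s : ℕ} (hxy : x * q' + q' * q ≤ y * q' + s * q) :
      x * q' / q + q' ≤ y * q' / q + s := by
    rw [← Nat.add_mul_div_right _ _ hq, ← Nat.add_mul_div_right _ _ hq]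
    exact Nat.div_le_div_right hxy
  have hscale {x y : ℕ} (h₁ : x + q ≤ y) (h₂ : y + q ≤ x + p) :
      x * q' / q + q' ≤ y * q' / q ∧ y * q' / q + q' ≤ x * q' / q + p' :=
    ⟨hdiv (s := 0) (by nlinarith), hdiv (by nlinarith)⟩
  refine ⟨⟨fun x => ⟨x * q' / q, Nat.div_lt_of_lt_mul ?_⟩, fun {a b} hab => ?_⟩⟩
  · calc x * q' < p * q' := Nat.mul_lt_mul_of_pos_right x.2 hq'
      _ ≤ q * p' := by rwa [mul_comm q]
  · rw [circularClique_adj_iff hq] at hab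
    rw [circularClique_adj_iff hq']
    exact hab.imp (fun h => hscale h.1 h.2) fun h => hscale h.1 h.2

theorem natCast_add_eq_iff {a b : Fin (2 * q + 1)} :
    ((b : ℕ) : ZMod (2 * q + 1)) = (a : ℕ) + (q : ZMod (2 * q + 1)) ↔
      (a : ℕ) + q = b ∨ (b : ℕ) + q + 1 = a := by
  rw [← Nat.cast_add, ZMod.natCast_eq_natCast_iff', Nat.mod_eq_of_lt b.2]
  rcases lt_or_ge ((a : ℕ) + q) (2 * q + 1) with h | h
  · rw [Nat.mod_eq_of_lt h]
    omega
  · rw [Nat.mod_eq_sub_mod h, Nat.mod_eq_of_lt (by omega)]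
    omega

/-- The odd circular clique `G_{2q+1,q}` is a cycle, in which `x` is followed by `x + q`. -/
def circularCliqueIsoCirculantGraph (hq : 0 < q) :
    circularClique (2 * q + 1) q ≃g SimpleGraph.circulantGraph {(q : ZMod (2 * q + 1))} where
  toFun a := (a : ℕ)
  invFun x := ⟨x.val, x.val_lt⟩
  left_inv a := Fin.ext (ZMod.val_natCast_of_lt a.2)
  right_inv x := ZMod.natCast_zmod_val x
  map_rel_iff' {a b} := by
    have hcast : ((a : ℕ) : ZMod (2 * q + 1)) = (b : ℕ) ↔ (a : ℕ) = b := by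
      rw [ZMod.natCast_eq_natCast_iff', Nat.mod_eq_of_lt a.2, Nat.mod_eq_of_lt b.2]
    rw [Equiv.coe_fn_mk, circulantGraph_singleton_adj, ne_eq, hcast, natCast_add_eq_iff,
      natCast_add_eq_iff, circularClique_adj_iff hq]
    omega

theorem mem_zmultiples_natCast (x : ZMod (2 * q + 1)) :
    x ∈ AddSubgroup.zmultiples (q : ZMod (2 * q + 1)) := by
  refine AddSubgroup.mem_zmultiples_iff.2 ⟨-2 * (x.val : ℤ), ?_⟩
  have h : (2 * q + 1 : ZMod (2 * q + 1)) = 0 := by exact_mod_cast ZMod.natCast_self (2 * q + 1)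
  rw [zsmul_eq_mul]
  push_cast
  rw [ZMod.natCast_zmod_val]
  linear_combination -x * h

theorem not_adj_of_isIndepSet {V : Type*} {G : SimpleGraph V} {s : Set V} (hs : G.IsIndepSet s)
    {a b : V} (ha : a ∈ s) (hb : b ∈ s) : ¬ G.Adj a b :=
  fun hab => hs ha hb hab.ne hab

theorem indepNum_circularClique_le (hq : 0 < q) (hpq : 2 * q ≤ p) :
    (circularClique p q).indepNum ≤ q := by
  obtain ⟨s, hs, hcard⟩ := (circularClique p q).exists_isNIndepSet_indepNum
  rw [← hcard]
  rcases s.eq_empty_or_nonempty with rfl | hne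
  · simp
  obtain ⟨x, hx, hmin⟩ := s.exists_min_image (fun y : Fin p => (y : ℕ)) hne
  have hnadj {a b : Fin p} (ha : a ∈ s) (hb : b ∈ s) :=
    (circularClique_adj_iff hq).not.1 (not_adj_of_isIndepSet hs ha hb)
  rw [← Finset.card_range q]
  -- `s` lies in the union of `[x, x + q)` and its shift by `p - q`, and `y` is adjacent to its
  -- shift.
  refine Finset.card_le_card_of_injOn
    (fun y => if (y : ℕ) < x + q then (y : ℕ) - x else y + q - x - p) ?_ ?_
  · intro y hy
    have := hmin y hy
    have := hnadj hx hy
    simp only [Finset.coe_range, Set.mem_Iio]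
    split_ifs <;> omega
  · intro y hy z hz h
    have := hmin y hy
    have := hmin z hz
    have := hnadj hx hy
    have := hnadj hx hz
    have := hnadj hy hz
    simp only at h
    apply Fin.ext
    split_ifs at h <;> omega

theorem card_le_of_isIndepSet_deleteEdges (hq : 2 ≤ q) (hpq : 2 * q + 2 ≤ p) {u w : Fin p}
    (hu : (u : ℕ) = 0) (hw : (w : ℕ) = q + 1) {s : Finset (Fin p)} (hus : u ∈ s) (hws : w ∈ s)
    (hs : ((circularClique p q).deleteEdges {s(u, w)}).IsIndepSet s) : s.card ≤ q := by
  have hnadj {a b : Fin p} (ha : a ∈ s) (hb : b ∈ s) :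
      ¬ (((a : ℕ) + q ≤ b ∧ (b : ℕ) + q ≤ a + p) ∧ ¬ ((a : ℕ) = 0 ∧ (b : ℕ) = q + 1)) := by
    rintro ⟨hab, hne⟩
    refine not_adj_of_isIndepSet hs ha hb
      (SimpleGraph.deleteEdges_adj.2 ⟨(circularClique_adj_iff (by omega)).2 (Or.inl hab), ?_⟩)
    rw [Set.mem_singleton_iff, Sym2.eq_iff]
    rintro (⟨rfl, rfl⟩ | ⟨rfl, rfl⟩) <;> omega
  have hrange {y : Fin p} (hy : y ∈ s) : (y : ℕ) = 0 ∨ (y : ℕ) = q + 1 ∨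
      (2 ≤ (y : ℕ) ∧ (y : ℕ) < q) ∨ (p < (y : ℕ) + q ∧ (y : ℕ) ≤ 2 * q) := by
    have := hnadj hus hy
    have := hnadj hws hy
    have := hnadj hy hws
    omega
  rw [← Finset.card_range q]
  -- `s` misses `1`, which can serve as the image of `q + 1`; vertices above `p - q` are shifted
  -- down by `q + 1`, and among the remaining vertices those at distance `q + 1` are adjacent.
  refine Finset.card_le_card_of_injOn (fun y => if (y : ℕ) = q + 1 then 1 else
    if (y : ℕ) < q then (y : ℕ) else y - (q + 1)) (fun y hy => ?_) fun y hy z hz h => ?_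
  · have := hrange hy
    simp only [Finset.coe_range, Set.mem_Iio]
    split_ifs <;> omega
  · have := hrange hy
    have := hrange hz
    have := hnadj hy hz
    have := hnadj hz hy
    simp only at h
    apply Fin.ext
    split_ifs at h <;> omega

theorem indepNum_circularClique_deleteEdges_le (hq : 2 ≤ q) (hpq : 2 * q + 2 ≤ p) {u w : Fin p}
    (hu : (u : ℕ) = 0) (hw : (w : ℕ) = q + 1) :
    ((circularClique p q).deleteEdges {s(u, w)}).indepNum ≤ q := by
  obtain ⟨s, hs, hcard⟩ := ((circularClique p q).deleteEdges {s(u, w)}).exists_isNIndepSet_indepNum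
  rw [← hcard]
  by_cases huw : u ∈ s ∧ w ∈ s
  · exact card_le_of_isIndepSet_deleteEdges hq hpq hu hw huw.1 huw.2 hs
  · have hs' : (circularClique p q).IsIndepSet s := fun a ha b hb hne hab => by
      refine hs ha hb hne (SimpleGraph.deleteEdges_adj.2 ⟨hab, fun h => huw ?_⟩)
      rw [Set.mem_singleton_iff, Sym2.eq_iff] at h
      obtain ⟨rfl, rfl⟩ | ⟨rfl, rfl⟩ := h
      exacts [⟨ha, hb⟩, ⟨hb, ha⟩]
    exact hs'.card_le_indepNum.trans (indepNum_circularClique_le (by omega) (by omega))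

theorem isEdgeReachable_two_of_common_neighbors {V : Type*} {G : SimpleGraph V} {x y z w : V}
    (hzw : z ≠ w) (hxz : G.Adj x z) (hzy : G.Adj z y) (hxw : G.Adj x w) (hwy : G.Adj w y) :
    G.IsEdgeReachable 2 x y := by
  rcases eq_or_ne x y with rfl | hxy
  · rfl
  refine SimpleGraph.isEdgeReachable_two.2 fun e => ?_
  by_cases he : e = s(x, z) ∨ e = s(z, y)
  · have hxw' : (G.deleteEdges {e}).Adj x w := by
      rw [SimpleGraph.deleteEdges_adj, Set.mem_singleton_iff]
      grind [hxw.ne, hwy.ne]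
    have hwy' : (G.deleteEdges {e}).Adj w y := by
      rw [SimpleGraph.deleteEdges_adj, Set.mem_singleton_iff]
      grind [hxw.ne, hwy.ne]
    exact hxw'.reachable.trans hwy'.reachable
  · have hxz' : (G.deleteEdges {e}).Adj x z := SimpleGraph.deleteEdges_adj.2
      ⟨hxz, fun h => he (Or.inl h.symm)⟩
    have hzy' : (G.deleteEdges {e}).Adj z y := SimpleGraph.deleteEdges_adj.2
      ⟨hzy, fun h => he (Or.inr h.symm)⟩
    exact hxz'.reachable.trans hzy'.reachable

theorem isEdgeReachable_two_circularClique_succ (hq : 0 < q) (hpq : 2 * q + 2 ≤ p) {v : ℕ}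
    (hv : v + 1 < p) :
    (circularClique p q).IsEdgeReachable 2 ⟨v, by omega⟩ ⟨v + 1, hv⟩ := by
  have hnbrs {z w : ℕ} (hz : z < p) (hw : w < p) (hzw : z ≠ w)
      (hadj : ∀ x : ℕ, x = z ∨ x = w →
        v + q + 1 ≤ x ∧ x + q ≤ v + p ∨ x + q ≤ v ∧ v + q + 1 ≤ x + p) :
      (circularClique p q).IsEdgeReachable 2 ⟨v, by omega⟩ ⟨v + 1, hv⟩ := by
    have := hadj z (Or.inl rfl)
    have := hadj w (Or.inr rfl)
    apply isEdgeReachable_two_of_common_neighbors (z := ⟨z, hz⟩) (w := ⟨w, hw⟩)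
      (fun h => hzw (Fin.mk.inj h)) <;> rw [circularClique_adj_iff hq] <;> simp only <;> omega
  by_cases hlt : v + q + 2 < p
  · exact hnbrs (z := v + q + 1) (w := v + q + 2) (by omega) hlt (by omega) (by omega)
  by_cases hle : q + 1 ≤ v
  · exact hnbrs (z := v - q) (w := v - q - 1) (by omega) (by omega) (by omega) (by omega)
  · exact hnbrs (z := v + q + 1) (w := 0) (by omega) (by omega) (by omega) (by omega)

theorem isEdgeConnected_two_circularClique (hq : 0 < q) (hpq : 2 * q + 2 ≤ p) :
    (circularClique p q).IsEdgeConnected 2 := by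
  have hzero (v : ℕ) (hv : v < p) :
      (circularClique p q).IsEdgeReachable 2 ⟨0, by omega⟩ ⟨v, hv⟩ := by
    induction v with
    | zero => rfl
    | succ v ih => exact (ih _).trans (isEdgeReachable_two_circularClique_succ hq hpq hv)
  exact fun a b => (hzero a a.2).symm.trans (hzero b b.2)

end CircularCliques

section CircularChromaticNumber

variable {V : Type u} {G : SimpleGraph V} {p q : ℕ} {r : ℚ}

theorem card_filter_val_sub_lt {n m : ℕ} (x : Fin n) :
    (Finset.univ.filter fun i : Fin n => ((x - i : Fin n) : ℕ) < m).card = min n m := by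
  have : NeZero n := ⟨x.pos.ne'⟩
  rw [← Fin.card_filter_val_lt]
  exact Finset.card_equiv (Equiv.subLeft x) (by simp)

theorem not_adj_of_val_sub_lt (hq : 0 < q) {a b i : Fin p} (ha : ((a - i : Fin p) : ℕ) < q)
    (hb : ((b - i : Fin p) : ℕ) < q) : ¬ (circularClique p q).Adj a b := by
  have hval (x : Fin p) : ((x - i : Fin p) : ℕ) = x - i ∧ i ≤ x ∨
      ((x - i : Fin p) : ℕ) = p + x - i ∧ x < i :=
    (le_or_gt i x).imp (fun h => ⟨Fin.coe_sub_iff_le.2 h, h⟩) fun h => ⟨Fin.coe_sub_iff_lt.2 h, h⟩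
  have := hval a
  have := hval b
  rw [circularClique_adj_iff hq]
  omega

theorem card_mul_le_mul_indepNum [Fintype V] (hq : 0 < q) (hqp : q ≤ p)
    (c : G →g circularClique p q) : Fintype.card V * q ≤ p * G.indepNum := by
  have hcount := Finset.card_mul_le_card_mul (s := (Finset.univ : Finset V))
    (t := (Finset.univ : Finset (Fin p))) (m := q) (n := G.indepNum)
    (fun v i => ((c v - i : Fin p) : ℕ) < q)
    (fun v _ => ((card_filter_val_sub_lt (c v)).trans (min_eq_right hqp)).ge)
    fun i _ => SimpleGraph.IsIndepSet.card_le_indepNum fun v hv w hw _ hvw =>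
      not_adj_of_val_sub_lt hq (Finset.mem_filter.1 hv).2 (Finset.mem_filter.1 hw).2 (c.map_adj hvw)
  simpa using hcount

theorem isCircularChromaticNumber_of_indepNum_le [Fintype V] (hq : 0 < q) (hqp : q ≤ p)
    (c : G →g circularClique p q) (hV : Fintype.card V = p) (hG : G.indepNum ≤ q) :
    IsCircularChromaticNumber G ((p : ℚ) / q) := by
  refine ⟨⟨p, q, hq, hqp, rfl, ⟨c⟩⟩, ?_⟩
  rintro _ ⟨a, b, hb, hba, rfl, ⟨c'⟩⟩
  have h : p * b ≤ a * q := by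
    rw [← hV]
    exact (card_mul_le_mul_indepNum hb hba c').trans (Nat.mul_le_mul_left a hG)
  rw [div_le_div_iff₀ (by positivity) (by positivity)]
  exact_mod_cast h

theorem IsCircularChromaticNumber.nonempty_hom_iff (h : IsCircularChromaticNumber G r)
    (hq : 0 < q) (hqp : q ≤ p) : Nonempty (G →g circularClique p q) ↔ r ≤ (p : ℚ) / q := by
  refine ⟨fun hc => h.2 ⟨p, q, hq, hqp, rfl, hc⟩, fun hr => ?_⟩
  obtain ⟨a, b, hb, -, rfl, ⟨c⟩⟩ := h.1
  rw [div_le_div_iff₀ (by positivity) (by positivity)] at hr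
  obtain ⟨e⟩ := nonempty_circularClique_hom_of_mul_le hb hq (by exact_mod_cast hr)
  exact ⟨e.comp c⟩

theorem IsCircularChromaticNumber.colorable_iff (h : IsCircularChromaticNumber G r) {k : ℕ}
    (hk : 0 < k) : G.Colorable k ↔ r ≤ k := by
  have hiff := h.nonempty_hom_iff one_pos hk
  rwa [circularClique_one, Nat.cast_one, div_one] at hiff

theorem foldsTo_circularClique_one [Finite V] (hp : 2 ≤ p) (hG : G.Connected)
    (h : IsCircularChromaticNumber G p) : FoldsTo G (circularClique p 1) := by
  obtain ⟨k, rfl⟩ : ∃ k, p = k + 1 := ⟨p - 1, by omega⟩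
  rw [circularClique_one]
  refine foldsTo_top_of_chromaticNumber_eq hG ?_
  refine SimpleGraph.chromaticNumber_eq_iff_colorable_not_colorable.2 ⟨?_, ?_⟩
  · exact (h.colorable_iff k.succ_pos).2 le_rfl
  · rw [h.colorable_iff (by omega)]
    push_cast
    linarith

theorem foldsTo_circularClique_two_mul_add_one [Finite V] (hq : 0 < q) (hG : G.Connected)
    (h : IsCircularChromaticNumber G ((2 * q + 1 : ℕ) / q)) :
    FoldsTo G (circularClique (2 * q + 1) q) := by
  obtain ⟨c⟩ := (h.nonempty_hom_iff hq (by omega)).2 le_rfl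
  have h2 : ¬ G.Colorable 2 := by
    rw [h.colorable_iff two_pos, not_le, lt_div_iff₀ (by positivity)]
    norm_cast
    omega
  let e := circularCliqueIsoCirculantGraph hq
  exact (foldsTo_circulantGraph_singleton hG h2 mem_zmultiples_natCast (e.toHom.comp c)).trans_iso
    e.symm

theorem exists_not_foldsTo_circularClique_two_mul (hq : 2 ≤ q) :
    ∃ (n : ℕ) (G : SimpleGraph (Fin n)), G.Connected ∧
      IsCircularChromaticNumber G ((2 * q : ℕ) / q) ∧ ¬ FoldsTo G (circularClique (2 * q) q) := by
  refine ⟨2, circularClique 2 1, ?_, ?_, fun h => ?_⟩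
  · rw [circularClique_one]
    exact SimpleGraph.connected_top
  · have h := isCircularChromaticNumber_of_indepNum_le one_pos one_le_two .id (Fintype.card_fin 2)
      (indepNum_circularClique_le one_pos le_rfl)
    have hq0 : (q : ℚ) ≠ 0 := by positivity
    convert h using 1
    push_cast
    field_simp
  · have hcard := h.card_le
    rw [Nat.card_fin, Nat.card_fin] at hcard
    omega

theorem exists_not_foldsTo_circularClique (hq : 2 ≤ q) (hpq : 2 * q + 2 ≤ p) :
    ∃ (n : ℕ) (G : SimpleGraph (Fin n)), G.Connected ∧
      IsCircularChromaticNumber G ((p : ℚ) / q) ∧ ¬ FoldsTo G (circularClique p q) := by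
  let u : Fin p := ⟨0, by omega⟩
  let w : Fin p := ⟨q + 1, by omega⟩
  have huw : (circularClique p q).Adj u w :=
    (circularClique_adj_iff (by omega)).2 (Or.inl ⟨by grind, by grind⟩)
  have hlt : (circularClique p q).deleteEdges {s(u, w)} < circularClique p q := by
    refine (SimpleGraph.deleteEdges_le _).lt_of_not_ge fun hle => ?_
    exact (SimpleGraph.deleteEdges_adj.1 (hle huw)).2 rfl
  have hne : Nonempty (Fin p) := ⟨u⟩
  have hconn := isEdgeConnected_two_circularClique (by omega : 0 < q) hpq
  refine ⟨p, (circularClique p q).deleteEdges {s(u, w)},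
    ⟨SimpleGraph.isEdgeConnected_two.1 hconn s(u, w)⟩, ?_, not_foldsTo_of_lt hlt⟩
  exact isCircularChromaticNumber_of_indepNum_le (by omega) (by omega) (.ofLE hlt.le)
    (Fintype.card_fin p) (indepNum_circularClique_deleteEdges_le hq hpq rfl rfl)

end CircularChromaticNumber

theorem mainTheorem8 (p q : ℕ) (hq : 0 < q) (hpq : 2 * q ≤ p) :
    ((q = 1 ∨ p = 2 * q + 1) →
      ∀ (V : Type u) [Finite V] (G : SimpleGraph V), G.Connected →
        IsCircularChromaticNumber G ((p : ℚ) / (q : ℚ)) → FoldsTo G (circularClique p q)) ∧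
    (¬ (q = 1 ∨ p = 2 * q + 1) →
      ∃ (n : ℕ) (G : SimpleGraph (Fin n)), G.Connected ∧
        IsCircularChromaticNumber G ((p : ℚ) / (q : ℚ)) ∧ ¬ FoldsTo G (circularClique p q)) := by
  refine ⟨?_, fun h => ?_⟩
  · rintro (rfl | rfl) V _ G hG hr
    · exact foldsTo_circularClique_one hpq hG (by simpa using hr)
    · exact foldsTo_circularClique_two_mul_add_one hq hG hr
  · rcases hpq.eq_or_lt with rfl | hlt
    · exact exists_not_foldsTo_circularClique_two_mul (by omega)
    · exact exists_not_foldsTo_circularClique (by omega) (by omega)
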